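/- Let $\mathbb K$ be a field, let $n\ge 0$, and let $G$ be a tree on the vertex set $[n+1]=\{1,\dots,n+1\}$. In $S=\mathbb K[x_1,\dots,x_{n+1},y_1,\dots,y_{n+1}]$ put $f_e=x_iy_j-x_jy_i$ for an edge $e=\{i,j\}$, $i<j$, of $G$, and let $J_G=(f_e: e\in E(G))$ be the binomial edge ideal of $G$. A sequence $z_1,\dots,z_m$ in a commutative ring is called a $p$-sequence if (with $z_0=0$) (1) $z_1,\dots,z_m$ is a minimal system of generators of the ideal $(z_1,\dots,z_m)$, i.e. no $z_k$ lies in the ideal generated by the others; and (2) $(z_0,\dots,z_i):z_{i_1}z_{i_2}=(z_0,\dots,z_i):z_{i_1}$ for all $0\le i\le m-1$ and $i<i_1\le i_2\le m$. An ideal is called a $p$-sequence ideal if it is generated by some $p$-sequence. Let $x_0$ be a pendant vertex (a vertex of degree $1$) of $G$. Regard $G$ as a rooted tree with root $x_0$ and edges directed away from $x_0$; the level of an edge is the distance from $x_0$ to its endpoint further from $x_0$. A level ordering of $G$ from $x_0$ is a listing $e_1,\dots,e_n$ of all the edges of $G$, each exactly once, level by level in increasing order and from left to right within each level of a plane drawing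 of the rooted tree; that is, the levels are weakly increasing along the list, and whenever the edge $e_a$ ends at the starting vertex of $e_i$, the edge $e_b$ ends at the starting vertex of $e_j$, and $i\le j$, then $a\le b$. Theorem. For every pendant vertex $x_0$ of $G$ there is a level ordering of $G$ from $x_0$, and for every such level ordering $e_1,\dots,e_n$ the sequence $f_{e_1},\dots,f_{e_n}$ generates $J_G$ and is a $p$-sequence. Moreover, $J_G$ is a $p$-sequence ideal. -/

import Mathlib

/-- A sequence `z 0, …, z (n-1)` in a commutative ring (the `z₁, …, zₙ` of the text, indexed from
zero) is a *p-sequence* if it is a minimal system of generators of the ideal it generates (no term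
lies in the ideal generated by the others) and `(z₁, …, z_i) : z_{i₁} z_{i₂} = (z₁, …, z_i) : z_{i₁}`
for `0 ≤ i ≤ n - 1` and `i < i₁ ≤ i₂ ≤ n`. With zero-based indices the terms `z₁, …, z_i` are those
of index `< i`, and `i < i₁` becomes `i ≤ a`. -/
structure IsPSequence {A : Type*} [CommRing A] {n : ℕ} (z : Fin n → A) : Prop where
  minimal : ∀ i : Fin n, z i ∉ Ideal.span (z '' {j | j ≠ i})
  colon_eq : ∀ i a b : Fin n, i ≤ a → a ≤ b →
    (Ideal.span (z '' {j | j < i})).colon {z a * z b} =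
      (Ideal.span (z '' {j | j < i})).colon {z a}

/-- An ideal is a *p-sequence ideal* if some minimal generating set of it, suitably ordered, is a
p-sequence. (Minimality is part of `IsPSequence`.) -/
def IsPSequenceIdeal {A : Type*} [CommRing A] (I : Ideal A) : Prop :=
  ∃ (m : ℕ) (z : Fin m → A), Ideal.span (Set.range z) = I ∧ IsPSequence z

/-- The edge binomial `f_e = x_i y_j - x_j y_i` of `e = {i, j}`, `i < j`, in
`K[x_v, y_v : v ∈ V]`; here `x_v = X (Sum.inl v)` and `y_v = X (Sum.inr v)`. -/
noncomputable def edgeBinomial (K : Type*) [Field K] {V : Type*} [LinearOrder V] (e : Sym2 V) :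
    MvPolynomial (V ⊕ V) K :=
  MvPolynomial.X (Sum.inl e.inf) * MvPolynomial.X (Sum.inr e.sup) -
    MvPolynomial.X (Sum.inl e.sup) * MvPolynomial.X (Sum.inr e.inf)

/-- The binomial edge ideal `J_G`, generated by the edge binomials of `G`. -/
noncomputable def binomialEdgeIdeal (K : Type*) [Field K] {V : Type*} [LinearOrder V]
    (G : SimpleGraph V) : Ideal (MvPolynomial (V ⊕ V) K) :=
  Ideal.span (edgeBinomial K '' G.edgeSet)

/-- A pendant vertex: exactly one neighbour. -/
def IsPendant {V : Type*} (G : SimpleGraph V) (v : V) : Prop :=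
  ∃! w : V, G.Adj v w

/-- `e 0, …, e (m-1)` lists the edges of the rooted tree `(G, x₀)`, each directed away from the
root as (parent, child), level by level and from left to right inside each level of a plane
drawing: edges at a smaller level come first, and when a parent is further left
(its own incoming edge comes earlier), so are its children. -/
structure IsLevelOrdering {V : Type*} (G : SimpleGraph V) (x₀ : V) {m : ℕ}
    (e : Fin m → V × V) : Prop where
  /-- the edge is directed away from the root -/
  away : ∀ i, G.dist x₀ (e i).2 = G.dist x₀ (e i).1 + 1
  /-- every edge of `G` is listed exactly once -/
  injective : Function.Injective fun i => s((e i).1, (e i).2)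
  range_eq : (Set.range fun i => s((e i).1, (e i).2)) = G.edgeSet
  /-- edges are listed by increasing level -/
  level : ∀ i j, i ≤ j → G.dist x₀ (e i).2 ≤ G.dist x₀ (e j).2
  /-- left to right: if `e a` enters the parent of `e i` and `e b` enters the parent of `e j`,
  where `e i` precedes `e j`, then `e a` does not come after `e b` -/
  left_to_right : ∀ a b i j, (e a).2 = (e i).1 → (e b).2 = (e j).1 → i ≤ j → a ≤ b

/-!
Write `J_G` for the binomial edge ideal of `G` and `f_{uv} = x_u y_v - x_v y_u`. The argument works
with arbitrary finite graphs, and uses no initial ideals and no primary decompositions.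

For a vertex `p` let `G_p` be the graph obtained by joining all neighbours of `p` to one another.
The relation `x_p f_{ab} = x_a f_{pb} - x_b f_{pa}` shows that the variables at `p` multiply
`J_{G_p}` into `J_G`, and yields Ohtani's decomposition
`J_G = J_{G_p} ∩ (J_{G - p} + (x_p, y_p))` (`BinomialEdge.mem_minorIdeal_iff`). Passing from `G` to
`G_p` or `G - p` makes `p` a free vertex (one whose neighbourhood is a clique) and keeps all other
free vertices free. If every vertex is free, then `G` is a disjoint union of complete graphs and
`J_G` is the kernel of a monomial parametrization, hence prime
(`BinomialEdge.mem_of_segre_eq_zero`). By induction on the number of non-free vertices, `f_{wv}` is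
a non-zero-divisor modulo `J_G` whenever `w` is free and `v` is isolated
(`BinomialEdge.mem_of_mul_minor_mem`). Therefore `J_G : f_{uv} = J_{G_u}` for isolated `v`
(`BinomialEdge.mul_minor_mem_iff`).

Now let `H` be the graph of the first few edges of a level ordering, and let `e_a`, `e_b` with
`a ≤ b` be later edges, starting at `u` and `w`. The end vertices of `e_a` and `e_b` are isolated in
`H`. If `w ≠ u`, then by the level and left-to-right conditions no edge starting at `w` precedes
`e_a`, so `w` has at most one neighbour in `H`; hence `w` is free in `H_u` in all cases
(`IsLevelOrdering.isFree`). Consequently `f_{e_b}` is a non-zero-divisor modulo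
`J_{H_u} = J_H : f_{e_a}`, which is the colon condition of a p-sequence.
-/

namespace BinomialEdge

open MvPolynomial

/-! ### Edge ideals and two operations on graphs -/

/-- The maximal minor `x_u y_v - x_v y_u` of the generic `2 × V` matrix. Unlike `edgeBinomial` it
is attached to an ordered pair, so no order on `V` is needed. -/
noncomputable def minor (K : Type*) [Field K] {V : Type*} (u v : V) : MvPolynomial (V ⊕ V) K :=
  X (Sum.inl u) * X (Sum.inr v) - X (Sum.inl v) * X (Sum.inr u)

/-- The binomial edge ideal, generated by the minors of the ordered pairs of adjacent vertices. -/
noncomputable def minorIdeal (K : Type*) [Field K] {V : Type*} (G : SimpleGraph V) :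
    Ideal (MvPolynomial (V ⊕ V) K) :=
  Ideal.span {f | ∃ u v, G.Adj u v ∧ f = minor K u v}

/-- A free (or simplicial) vertex: its neighbours are pairwise adjacent. -/
def IsFree {V : Type*} (G : SimpleGraph V) (v : V) : Prop :=
  G.IsClique (G.neighborSet v)

/-- The graph `G_p`, obtained from `G` by joining all pairs of neighbours of `p`. -/
def completeAt {V : Type*} (G : SimpleGraph V) (p : V) : SimpleGraph V where
  Adj a b := G.Adj a b ∨ (a ≠ b ∧ G.Adj p a ∧ G.Adj p b)
  symm := ⟨fun _ _ h => h.imp (fun h => h.symm) fun h => ⟨h.1.symm, h.2.2, h.2.1⟩⟩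
  loopless := ⟨fun _ h => h.elim G.irrefl fun h => h.1 rfl⟩

/-- The graph `G - p`; the vertex `p` is kept, as an isolated vertex, so that the polynomial ring
does not change. -/
def isolate {V : Type*} (G : SimpleGraph V) (p : V) : SimpleGraph V where
  Adj a b := G.Adj a b ∧ a ≠ p ∧ b ≠ p
  symm := ⟨fun _ _ h => ⟨h.1.symm, h.2.2, h.2.1⟩⟩
  loopless := ⟨fun _ h => G.irrefl h.1⟩

section Graph

variable {V : Type*} {G : SimpleGraph V} {p v w : V}

lemma le_completeAt : G ≤ completeAt G p := fun _ _ h => Or.inl h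

lemma isolate_le : isolate G p ≤ G := fun _ _ h => h.1

lemma isFree_completeAt_self : IsFree (completeAt G p) p := by
  have key : ∀ a, (completeAt G p).Adj p a → G.Adj p a := fun a h =>
    h.elim id fun h => h.2.2
  exact fun a ha b hb hab => Or.inr ⟨hab, key a ha, key b hb⟩

lemma IsFree.completeAt (h : IsFree G v) : IsFree (completeAt G p) v := by
  intro a ha b hb hab
  simp only [SimpleGraph.mem_neighborSet, BinomialEdge.completeAt] at ha hb ⊢
  by_cases hpv : G.Adj p v
  · -- All neighbours of `v` other than `p` are neighbours of `p`.
    have key : ∀ c, c ≠ p → (G.Adj v c ∨ (v ≠ c ∧ G.Adj p v ∧ G.Adj p c)) → G.Adj p c := by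
      rintro c hc (h1 | h1)
      · exact h hpv.symm h1 hc.symm
      · exact h1.2.2
    by_cases hap : a = p
    · subst hap
      exact Or.inl (key b hab.symm hb)
    by_cases hbp : b = p
    · subst hbp
      exact Or.inl (key a hab ha).symm
    exact Or.inr ⟨hab, key a hap ha, key b hbp hb⟩
  · have key : ∀ c, (G.Adj v c ∨ (v ≠ c ∧ G.Adj p v ∧ G.Adj p c)) → G.Adj v c :=
      fun c hc => hc.elim id fun h => absurd h.2.1 hpv
    exact Or.inl (h (key a ha) (key b hb) hab)

lemma isFree_isolate_self : IsFree (isolate G p) p :=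
  fun _ ha => absurd rfl ha.2.1

lemma IsFree.isolate (h : IsFree G v) : IsFree (isolate G p) v :=
  fun _ ha _ hb hab => ⟨h ha.1 hb.1 hab, ha.2.2, hb.2.2⟩

lemma isFree_of_subsingleton (h : ∀ a b, G.Adj v a → G.Adj v b → a = b) : IsFree G v :=
  fun a ha b hb hab => absurd (h a b ha hb) hab

lemma not_adj_completeAt (h : ∀ a, ¬ G.Adj v a) (a : V) : ¬ (completeAt G p).Adj v a :=
  fun h' => h'.elim (h a) fun h' => h p h'.2.1.symm

end Graph

section EdgeIdeal

variable {K : Type*} [Field K] {V : Type*} {G : SimpleGraph V}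

lemma minor_mem {u v : V} (h : G.Adj u v) : minor K u v ∈ minorIdeal K G :=
  Ideal.subset_span ⟨u, v, h, rfl⟩

lemma minorIdeal_mono {H : SimpleGraph V} (h : G ≤ H) : minorIdeal K G ≤ minorIdeal K H :=
  Ideal.span_mono fun _ ⟨u, v, huv, hf⟩ => ⟨u, v, h huv, hf⟩

/-! ### Splitting an edge ideal at a vertex -/

/-- The ideal generated by the two variables at `p`. -/
noncomputable def varIdeal (K : Type*) [Field K] {V : Type*} (p : V) :
    Ideal (MvPolynomial (V ⊕ V) K) :=
  Ideal.span {X (Sum.inl p), X (Sum.inr p)}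

open Classical in
/-- The substitution of `0` for the two variables at `p`. -/
noncomputable def kill (K : Type*) [Field K] {V : Type*} (p : V) :
    MvPolynomial (V ⊕ V) K →ₐ[K] MvPolynomial (V ⊕ V) K :=
  aeval fun s => if Sum.elim id id s = p then 0 else X s

lemma sub_kill_mem (p : V) (a : MvPolynomial (V ⊕ V) K) : a - kill K p a ∈ varIdeal K p := by
  have h : (Ideal.Quotient.mkₐ K (varIdeal K p)).comp (kill K p) =
      Ideal.Quotient.mkₐ K (varIdeal K p) := by
    refine MvPolynomial.algHom_ext fun s => ?_
    simp only [kill, AlgHom.comp_apply, aeval_X]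
    split_ifs with hs
    · rw [map_zero, eq_comm, Ideal.Quotient.mkₐ_eq_mk, Ideal.Quotient.eq_zero_iff_mem]
      rcases s with s | s <;> (simp only [Sum.elim_inl, Sum.elim_inr, id] at hs; subst hs)
      · exact Ideal.subset_span (by simp)
      · exact Ideal.subset_span (by simp)
    · rfl
  rw [← Ideal.Quotient.eq, ← Ideal.Quotient.mkₐ_eq_mk K]
  exact (DFunLike.congr_fun h a).symm

lemma kill_minor_of_ne {p u v : V} (hu : u ≠ p) (hv : v ≠ p) :
    kill K p (minor K u v) = minor K u v := by
  simp [kill, minor, hu, hv]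

lemma kill_minor_of_eq {p u v : V} (h : u = p ∨ v = p) : kill K p (minor K u v) = 0 := by
  rcases h with rfl | rfl <;> simp [kill, minor]

/-- By the three-term relation `x_p f_{ab} = x_a f_{pb} - x_b f_{pa}` (and the same with `y`), the
variables at `p` multiply the new generators of `J_{G_p}` into `J_G`. -/
lemma varIdeal_mul_minorIdeal_completeAt_le (p : V) :
    varIdeal K p * minorIdeal K (completeAt G p) ≤ minorIdeal K G := by
  rw [varIdeal, minorIdeal, Ideal.span_mul_span', Ideal.span_le]
  rintro _ ⟨z, hz, _, ⟨a, b, hab, rfl⟩, rfl⟩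
  rcases hab with hab | ⟨-, ha, hb⟩
  · exact Ideal.mul_mem_left _ _ (minor_mem hab)
  · rcases hz with rfl | rfl
    · have : X (Sum.inl p) * minor K a b =
          X (Sum.inl a) * minor K p b - X (Sum.inl b) * minor K p a := by
        simp only [minor]; ring
      simp only [SetLike.mem_coe, this]
      exact sub_mem (Ideal.mul_mem_left _ _ (minor_mem hb)) (Ideal.mul_mem_left _ _ (minor_mem ha))
    · have : X (Sum.inr p) * minor K a b =
          X (Sum.inr a) * minor K p b - X (Sum.inr b) * minor K p a := by
        simp only [minor]; ring
      simp only [SetLike.mem_coe, this]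
      exact sub_mem (Ideal.mul_mem_left _ _ (minor_mem hb)) (Ideal.mul_mem_left _ _ (minor_mem ha))

lemma sub_kill_mem_of_mem_completeAt {p : V} {g : MvPolynomial (V ⊕ V) K}
    (hg : g ∈ minorIdeal K (completeAt G p)) : g - kill K p g ∈ minorIdeal K G := by
  induction hg using Submodule.span_induction with
  | mem f hf =>
    obtain ⟨a, b, hab, rfl⟩ := hf
    by_cases h : a = p ∨ b = p
    · have hab' : G.Adj a b := by
        rcases hab with hab | ⟨-, ha, hb⟩
        · exact hab
        · rcases h with rfl | rfl
          · exact absurd ha G.irrefl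
          · exact absurd hb G.irrefl
      rw [kill_minor_of_eq h, sub_zero]
      exact minor_mem hab'
    · push Not at h
      simp [kill_minor_of_ne h.1 h.2]
  | zero => simp
  | add x y _ _ hx hy =>
    rw [map_add, add_sub_add_comm]
    exact add_mem hx hy
  | smul a x hx ih =>
    have h := Ideal.mul_mem_mul (sub_kill_mem p a) hx
    have h1 := varIdeal_mul_minorIdeal_completeAt_le p h
    have : a • x - kill K p (a • x) = (a - kill K p a) * x + kill K p a * (x - kill K p x) := by
      rw [smul_eq_mul, map_mul]; ring
    rw [this]
    exact add_mem h1 (Ideal.mul_mem_left _ _ ih)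

lemma kill_mem_isolate {p : V} {g : MvPolynomial (V ⊕ V) K} (hg : g ∈ minorIdeal K G) :
    kill K p g ∈ minorIdeal K (isolate G p) := by
  suffices h : minorIdeal K G ≤ (minorIdeal K (isolate G p)).comap (kill K p) from h hg
  rw [minorIdeal, Ideal.span_le]
  rintro _ ⟨a, b, hab, rfl⟩
  simp only [SetLike.mem_coe, Ideal.mem_comap]
  by_cases h : a = p ∨ b = p
  · rw [kill_minor_of_eq h]
    exact zero_mem _
  · push Not at h
    rw [kill_minor_of_ne h.1 h.2]
    exact minor_mem ⟨hab, h⟩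

/-- Ohtani's decomposition `J_G = J_{G_p} ∩ (J_{G - p} + (x_p, y_p))`. Membership in the second
ideal is expressed by substituting `0` for `x_p` and `y_p`. -/
theorem mem_minorIdeal_iff (p : V) {g : MvPolynomial (V ⊕ V) K} :
    g ∈ minorIdeal K G ↔
      g ∈ minorIdeal K (completeAt G p) ∧ kill K p g ∈ minorIdeal K (isolate G p) := by
  refine ⟨fun h => ⟨minorIdeal_mono le_completeAt h, kill_mem_isolate h⟩, fun ⟨h1, h2⟩ => ?_⟩
  have := add_mem (sub_kill_mem_of_mem_completeAt h1) (minorIdeal_mono isolate_le h2)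
  rwa [sub_add_cancel] at this

/-! ### Disjoint unions of complete graphs -/

section Segre

variable {ι : Type*}

/-- The exponent vectors of the images of the variables under `segre`. -/
noncomputable def segreVar (r : V → ι) : V ⊕ V → (V ⊕ ι →₀ ℕ) :=
  Sum.elim (fun v => Finsupp.single (Sum.inl v) 1)
    fun v => Finsupp.single (Sum.inl v) 1 + Finsupp.single (Sum.inr (r v)) 1

/-- The effect of `segre` on exponent vectors. -/
noncomputable def segreExp (r : V → ι) : (V ⊕ V →₀ ℕ) →ₗ[ℕ] (V ⊕ ι →₀ ℕ) :=
  Finsupp.linearCombination ℕ (segreVar r)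

/-- The parametrization `x_v ↦ s_v`, `y_v ↦ s_v t_{r v}` of the rank one `2 × V` matrices on each
fibre of `r`. -/
noncomputable def segre (K : Type*) [Field K] (r : V → ι) :
    MvPolynomial (V ⊕ V) K →ₐ[K] MvPolynomial (V ⊕ ι) K :=
  aeval fun s => monomial (segreVar r s) 1

lemma segre_monomial (r : V → ι) (m : V ⊕ V →₀ ℕ) (c : K) :
    segre K r (monomial m c) = monomial (segreExp r m) c := by
  rw [segre, aeval_monomial, segreExp, Finsupp.linearCombination_apply,
    monomial_finsupp_sum_index]
  simp [monomial_pow, algebraMap_eq]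

lemma segre_minor (r : V → ι) (u v : V) :
    segre K r (minor K u v) = X (Sum.inl u) * X (Sum.inl v) *
      (X (Sum.inr (r v)) - X (Sum.inr (r u))) := by
  have h : ∀ s : V ⊕ ι, (monomial (Finsupp.single s 1) (1 : K)) = X s := fun s => rfl
  have h2 : ∀ s t : V ⊕ ι,
      (monomial (Finsupp.single s 1 + Finsupp.single t 1) (1 : K)) = X s * X t := fun s t => by
    rw [← h, ← h, monomial_mul, one_mul]
  simp only [segre, minor, map_sub, map_mul, aeval_X, segreVar, Sum.elim_inl, Sum.elim_inr, h, h2]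
  ring

variable [Fintype V]

lemma segreExp_inl (r : V → ι) (m : V ⊕ V →₀ ℕ) (v : V) :
    segreExp r m (Sum.inl v) = m (Sum.inl v) + m (Sum.inr v) := by
  classical
  simp [segreExp, Finsupp.linearCombination_apply, Finsupp.sum_fintype, segreVar,
    Finsupp.single_apply]

open Classical in
lemma segreExp_inr (r : V → ι) (m : V ⊕ V →₀ ℕ) (c : ι) :
    segreExp r m (Sum.inr c) = ∑ v with r v = c, m (Sum.inr v) := by
  simp [segreExp, Finsupp.linearCombination_apply, Finsupp.sum_fintype, segreVar,
    Finsupp.single_apply, Finset.sum_filter]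

/-- If vertices in the same fibre of `r` are adjacent, monomials with the same image under `segre`
are congruent modulo `J_G`: replacing `x_j y_i` by `x_i y_j` moves one monomial to the other. -/
lemma monomial_sub_monomial_mem {r : V → ι} (hr : ∀ u v, u ≠ v → r u = r v → G.Adj u v)
    (m m' : V ⊕ V →₀ ℕ) (h : segreExp r m = segreExp r m') :
    monomial m (1 : K) - monomial m' 1 ∈ minorIdeal K G := by
  classical
  induction hN : ∑ v, (m (Sum.inr v) - m' (Sum.inr v)) using Nat.strong_induction_on
    generalizing m with
  | _ N ih =>
  have hl : ∀ v, m (Sum.inl v) + m (Sum.inr v) = m' (Sum.inl v) + m' (Sum.inr v) := fun v => by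
    rw [← segreExp_inl r, ← segreExp_inl r, h]
  have hc : ∀ c, ∑ v with r v = c, m (Sum.inr v) = ∑ v with r v = c, m' (Sum.inr v) := fun c => by
    rw [← segreExp_inr, ← segreExp_inr, h]
  by_cases hle : ∀ v, m (Sum.inr v) ≤ m' (Sum.inr v)
  · have heq : ∀ v, m (Sum.inr v) = m' (Sum.inr v) := fun v =>
      (Finset.sum_eq_sum_iff_of_le fun i _ => hle i).1 (hc (r v)) v (by simp)
    have : m = m' := by
      ext (v | v)
      · have := hl v; have := heq v; omega
      · exact heq v
    rw [this, sub_self]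
    exact zero_mem _
  push Not at hle
  obtain ⟨i, hi⟩ := hle
  obtain ⟨j, hj, hji⟩ : ∃ j, r j = r i ∧ m (Sum.inr j) < m' (Sum.inr j) := by
    by_contra! hcon
    refine (hc (r i)).not_gt (Finset.sum_lt_sum ?_ ⟨i, by simp, hi⟩)
    intro v hv
    exact hcon v (by simpa using hv)
  have hij : j ≠ i := by rintro rfl; omega
  have hjl : 0 < m (Sum.inl j) := by have := hl j; omega
  obtain ⟨d, hd⟩ : ∃ d, m = d + (Finsupp.single (Sum.inl j) 1 + Finsupp.single (Sum.inr i) 1) := by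
    refine ⟨m - (Finsupp.single (Sum.inl j) 1 + Finsupp.single (Sum.inr i) 1),
      (tsub_add_cancel_of_le ?_).symm⟩
    intro s
    rcases s with v | v
    · simp only [Finsupp.add_apply, Finsupp.single_apply, reduceCtorEq, if_false, add_zero,
        Sum.inl.injEq]
      split_ifs with hv
      · subst hv; omega
      · omega
    · simp only [Finsupp.add_apply, Finsupp.single_apply, reduceCtorEq, if_false, zero_add,
        Sum.inr.injEq]
      split_ifs with hv
      · subst hv; omega
      · omega
  set m₁ : V ⊕ V →₀ ℕ := d + (Finsupp.single (Sum.inl i) 1 + Finsupp.single (Sum.inr j) 1)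
    with hm₁
  have hexp : segreExp r m₁ = segreExp r m := by
    rw [hm₁, hd]
    simp only [map_add, segreExp, Finsupp.linearCombination_single, segreVar, Sum.elim_inl,
      Sum.elim_inr, one_smul, hj]
    abel
  have hstep : monomial m (1 : K) - monomial m₁ 1 = monomial d 1 * minor K j i := by
    have h2 : ∀ s t : V ⊕ V, (monomial (d + (Finsupp.single s 1 + Finsupp.single t 1)) (1 : K)) =
        monomial d 1 * (X s * X t) := fun s t => by
      simp only [X, monomial_mul, one_mul]
    rw [hd, hm₁, h2, h2, minor]
    ring
  have hlt : ∑ v, (m₁ (Sum.inr v) - m' (Sum.inr v)) < N := by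
    have hval : ∀ v, m₁ (Sum.inr v) + (if i = v then 1 else 0) =
        m (Sum.inr v) + if j = v then 1 else 0 := fun v => by
      rw [hm₁, hd]
      simp [Finsupp.single_apply]
      ring
    rw [← hN]
    refine Finset.sum_lt_sum (fun v _ => ?_) ⟨i, Finset.mem_univ _, ?_⟩
    · have := hval v
      by_cases hjv : j = v
      · subst hjv
        simp [hij.symm] at this
        omega
      · simp only [hjv, if_false] at this
        omega
    · have := hval i
      simp [hij] at this
      omega
  have := add_mem (Ideal.mul_mem_left _ (monomial d 1) (minor_mem (K := K) (hr j i hij hj)))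
    (ih _ hlt m₁ (hexp.trans h) rfl)
  rwa [← hstep, sub_add_sub_cancel] at this

lemma mem_of_segre_eq_zero {r : V → ι} (hr : ∀ u v, u ≠ v → r u = r v → G.Adj u v)
    {g : MvPolynomial (V ⊕ V) K} (hg : segre K r g = 0) : g ∈ minorIdeal K G := by
  -- A linear map sending each monomial in the image of `segre` to a chosen preimage.
  let ψ : MvPolynomial (V ⊕ ι) K →ₗ[K] MvPolynomial (V ⊕ V) K :=
    (basisMonomials (V ⊕ ι) K).constr K fun d => monomial (Function.invFun (segreExp r) d) 1
  have hψ : ∀ d c, ψ (monomial d c) = monomial (Function.invFun (segreExp r) d) c := fun d c => by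
    have h1 : monomial d c = c • basisMonomials (V ⊕ ι) K d := by
      rw [coe_basisMonomials, smul_monomial, smul_eq_mul, mul_one]
    rw [h1, map_smul, Module.Basis.constr_basis, smul_monomial, smul_eq_mul, mul_one]
  have key : ∀ p, p - ψ (segre K r p) ∈ minorIdeal K G := by
    intro p
    induction p using MvPolynomial.induction_on' with
    | monomial m c =>
      rw [segre_monomial, hψ]
      have h1 := monomial_sub_monomial_mem (K := K) hr m
        (Function.invFun (segreExp r) (segreExp r m)) (Function.invFun_eq ⟨m, rfl⟩).symm
      have h2 := Ideal.mul_mem_left _ (C c) h1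
      simpa [mul_sub, C_mul_monomial] using h2
    | add p q hp hq =>
      rw [map_add, map_add, add_sub_add_comm]
      exact add_mem hp hq
  simpa [hg] using key g

end Segre

/-- If all vertices are free, `G` is a disjoint union of complete graphs, and `J_G` is prime, being
the kernel of `segre` for the map to connected components. -/
lemma mem_of_mul_minor_mem_of_forall_isFree [Fintype V] (hG : ∀ v, IsFree G v) {w v : V}
    (hwv : w ≠ v) (hv : ∀ a, ¬ G.Adj v a) {g : MvPolynomial (V ⊕ V) K}
    (h : g * minor K w v ∈ minorIdeal K G) : g ∈ minorIdeal K G := by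
  classical
  let S : Setoid V :=
    { r := fun a b => a = b ∨ G.Adj a b
      iseqv :=
        { refl := fun _ => Or.inl rfl
          symm := fun h => h.imp Eq.symm fun h => h.symm
          trans := by
            rintro a b c (rfl | hab) (rfl | hbc)
            · exact Or.inl rfl
            · exact Or.inr hbc
            · exact Or.inr hab
            · by_cases hac : a = c
              · exact Or.inl hac
              · exact Or.inr (hG b hab.symm hbc hac) } }
  let r : V → Quotient S := Quotient.mk S
  have hr : ∀ a b, r a = r b ↔ a = b ∨ G.Adj a b := fun a b => Quotient.eq
  refine mem_of_segre_eq_zero (r := r) (fun a b hab h => ((hr a b).1 h).resolve_left hab) ?_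
  have hker : minorIdeal K G ≤ RingHom.ker (segre K r) := by
    rw [minorIdeal, Ideal.span_le]
    rintro _ ⟨a, b, hab, rfl⟩
    rw [SetLike.mem_coe, RingHom.mem_ker, segre_minor, (hr a b).2 (Or.inr hab), sub_self, mul_zero]
  have h0 := hker h
  rw [RingHom.mem_ker, map_mul, segre_minor] at h0
  refine (mul_eq_zero.1 h0).resolve_right (mul_ne_zero (mul_ne_zero (X_ne_zero _) (X_ne_zero _)) ?_)
  rw [sub_ne_zero, Ne, X_inj, Sum.inr.injEq, hr]
  rintro (h | h)
  · exact hwv h.symm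
  · exact hv w h

/-! ### Colon ideals -/

/-- If `w` is free and `v` is isolated in `G`, then `f_{wv}` is a non-zero-divisor modulo `J_G`.
Splitting `J_G` at a non-free vertex decreases the number of non-free vertices and does not affect
`f_{wv}`, which reduces the claim to graphs whose vertices are all free. -/
theorem mem_of_mul_minor_mem [Finite V] {w v : V} (hw : IsFree G w) (hv : ∀ a, ¬ G.Adj v a)
    (hwv : w ≠ v) {g : MvPolynomial (V ⊕ V) K} (h : g * minor K w v ∈ minorIdeal K G) :
    g ∈ minorIdeal K G := by
  cases nonempty_fintype V
  induction hN : Set.ncard {p | ¬ IsFree G p} using Nat.strong_induction_on generalizing G g with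
  | _ N ih =>
  by_cases hfree : ∀ p, IsFree G p
  · exact mem_of_mul_minor_mem_of_forall_isFree hfree hwv hv h
  push Not at hfree
  obtain ⟨p, hp⟩ := hfree
  have hpw : w ≠ p := by rintro rfl; exact hp hw
  have hpv : v ≠ p := by
    rintro rfl
    exact hp fun a ha => absurd ha (hv a)
  have hlt : ∀ H : SimpleGraph V, (∀ q, IsFree G q → IsFree H q) → IsFree H p →
      Set.ncard {q | ¬ IsFree H q} < N := by
    intro H hH hHp
    rw [← hN]
    refine Set.ncard_lt_ncard ⟨fun q hq hGq => hq (hH q hGq), fun hsub => ?_⟩ (Set.toFinite _)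
    exact hsub hp hHp
  rw [mem_minorIdeal_iff p] at h ⊢
  rw [map_mul, kill_minor_of_ne hpw hpv] at h
  exact ⟨ih _ (hlt _ (fun q hq => hq.completeAt) isFree_completeAt_self) hw.completeAt
      (not_adj_completeAt hv) h.1 rfl,
    ih _ (hlt _ (fun q hq => hq.isolate) isFree_isolate_self) hw.isolate
      (fun a ha => hv a ha.1) h.2 rfl⟩

/-- For an isolated vertex `v`, the colon ideal `J_G : f_{uv}` is `J_{G_u}`. -/
theorem mul_minor_mem_iff [Finite V] {u v : V} (hv : ∀ a, ¬ G.Adj v a) (huv : u ≠ v)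
    {g : MvPolynomial (V ⊕ V) K} :
    g * minor K u v ∈ minorIdeal K G ↔ g ∈ minorIdeal K (completeAt G u) := by
  refine ⟨fun h => mem_of_mul_minor_mem isFree_completeAt_self (not_adj_completeAt hv) huv
    (minorIdeal_mono le_completeAt h), fun h => ?_⟩
  have hf : minor K u v ∈ varIdeal K u :=
    sub_mem (Ideal.mul_mem_right _ _ (Ideal.subset_span (by simp)))
      (Ideal.mul_mem_left _ _ (Ideal.subset_span (by simp)))
  rw [mul_comm]
  exact varIdeal_mul_minorIdeal_completeAt_le u (Ideal.mul_mem_mul hf h)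

end EdgeIdeal

/-! ### The generators attached to a set of edges -/

section Generators

variable {K : Type*} [Field K] {V : Type*} [LinearOrder V]

lemma edgeBinomial_mk (u v : V) :
    edgeBinomial K s(u, v) = minor K u v ∨ edgeBinomial K s(u, v) = -minor K u v := by
  rcases le_total u v with h | h
  · left; simp [edgeBinomial, minor, h]
  · right; simp [edgeBinomial, minor, h]

lemma span_edgeBinomial_image (E : Set (Sym2 V)) :
    Ideal.span (edgeBinomial K '' E) = minorIdeal K (SimpleGraph.fromEdgeSet E) := by
  apply le_antisymm
  · rw [Ideal.span_le]
    rintro _ ⟨e, he, rfl⟩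
    induction e with
    | _ u v =>
      by_cases huv : u = v
      · subst huv
        simp [edgeBinomial]
      · have hm : minor K u v ∈ minorIdeal K (SimpleGraph.fromEdgeSet E) := minor_mem ⟨he, huv⟩
        rcases edgeBinomial_mk (K := K) u v with h | h <;> rw [h]
        · exact hm
        · exact neg_mem hm
  · rw [minorIdeal, Ideal.span_le]
    rintro _ ⟨u, v, ⟨huv, -⟩, rfl⟩
    have hm : edgeBinomial K s(u, v) ∈ Ideal.span (edgeBinomial K '' E) :=
      Ideal.subset_span ⟨_, huv, rfl⟩
    rcases edgeBinomial_mk (K := K) u v with h | h <;> rw [h] at hm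
    · exact hm
    · exact neg_mem_iff.1 hm

/-- At the point with `x_i = y_j = 1` and all other coordinates `0`, the only edge binomial that
does not vanish is that of the edge `{i, j}`. -/
lemma edgeBinomial_notMem_span {e : Sym2 V} (he : ¬ e.IsDiag) {E : Set (Sym2 V)} (heE : e ∉ E) :
    edgeBinomial K e ∉ Ideal.span (edgeBinomial K '' E) := by
  obtain ⟨i, j, hij, rfl⟩ : ∃ i j, i < j ∧ e = s(i, j) := by
    induction e with
    | _ u v =>
      rcases lt_or_gt_of_ne (a := u) (b := v) (by simpa using he) with h | h
      · exact ⟨u, v, h, rfl⟩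
      · exact ⟨v, u, h, Sym2.eq_swap⟩
  let φ : MvPolynomial (V ⊕ V) K →ₐ[K] K :=
    aeval (Sum.elim (fun v => if v = i then 1 else 0) fun v => if v = j then 1 else 0)
  have hle : Ideal.span (edgeBinomial K '' E) ≤ RingHom.ker φ := by
    rw [Ideal.span_le]
    rintro _ ⟨e', he', rfl⟩
    have hne : e' ≠ s(i, j) := by rintro rfl; exact heE he'
    obtain ⟨k, l, hkl, rfl⟩ : ∃ k l, k ≤ l ∧ e' = s(k, l) := by
      clear he' hne
      induction e' with
      | _ u v =>
        rcases le_total u v with h | h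
        · exact ⟨u, v, h, rfl⟩
        · exact ⟨v, u, h, Sym2.eq_swap⟩
    have h1 : ¬ (k = i ∧ l = j) := by rintro ⟨rfl, rfl⟩; exact hne rfl
    have h2 : ¬ (l = i ∧ k = j) := by rintro ⟨rfl, rfl⟩; exact hij.not_ge hkl
    simp only [SetLike.mem_coe, RingHom.mem_ker, edgeBinomial, Sym2.inf_mk, Sym2.sup_mk,
      inf_eq_left.2 hkl, sup_eq_right.2 hkl, map_sub, map_mul, φ, aeval_X, Sum.elim_inl,
      Sum.elim_inr, ite_zero_mul_ite_zero, if_neg h1, if_neg h2, sub_zero]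
  intro hmem
  have := hle hmem
  simp [RingHom.mem_ker, φ, edgeBinomial, inf_eq_left.2 hij.le, sup_eq_right.2 hij.le, hij.ne,
    hij.ne'] at this

end Generators

/-! ### Level orderings -/

section Level

variable {V : Type*} {G : SimpleGraph V} {x₀ : V} {m : ℕ} {e : Fin m → V × V}

lemma exists_parent (hG : G.Connected) (x₀ : V) {v : V} (hv : v ≠ x₀) :
    ∃ p, G.Adj p v ∧ G.dist x₀ v = G.dist x₀ p + 1 := by
  obtain ⟨q, hq⟩ := hG.exists_walk_length_eq_dist v x₀
  cases q with
  | nil => exact absurd rfl hv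
  | @cons _ p _ h q =>
    refine ⟨p, h.symm, le_antisymm ?_ ?_⟩
    · have h1 := hG.dist_triangle (u := x₀) (v := p) (w := v)
      rwa [SimpleGraph.dist_eq_one_iff_adj.2 h.symm] at h1
    · rw [G.dist_comm, G.dist_comm (u := x₀), ← hq, SimpleGraph.Walk.length_cons]
      exact Nat.succ_le_succ (SimpleGraph.dist_le q)

lemma _root_.IsLevelOrdering.snd_ne_root (he : IsLevelOrdering G x₀ e) (i : Fin m) :
    (e i).2 ≠ x₀ := by
  intro h
  have := he.away i
  rw [h, SimpleGraph.dist_self] at this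
  omega

lemma _root_.IsLevelOrdering.exists_snd_eq (he : IsLevelOrdering G x₀ e) (hG : G.Connected)
    {v : V} (hv : v ≠ x₀) : ∃ i, (e i).2 = v := by
  obtain ⟨p, hpv, hd⟩ := exists_parent hG x₀ hv
  have hmem : s(p, v) ∈ Set.range fun i => s((e i).1, (e i).2) := by
    rw [he.range_eq]; exact hpv
  obtain ⟨i, hi⟩ := hmem
  rcases Sym2.eq_iff.1 hi with ⟨-, h⟩ | ⟨h1, h2⟩
  · exact ⟨i, h⟩
  · have := he.away i
    rw [h1, h2] at this
    omega

/-- Distinct edges of the rooted tree enter distinct vertices: every vertex other than the root is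
entered, and there are as many such vertices as edges. -/
lemma _root_.IsLevelOrdering.snd_injective [Fintype V] (he : IsLevelOrdering G x₀ e)
    (hG : G.Connected) (hm : Fintype.card V = m + 1) : Function.Injective fun i => (e i).2 := by
  classical
  let f : Fin m → {v // v ≠ x₀} := fun i => ⟨(e i).2, he.snd_ne_root i⟩
  have hf : Function.Surjective f := fun ⟨v, hv⟩ => by
    obtain ⟨i, hi⟩ := he.exists_snd_eq hG hv
    exact ⟨i, Subtype.ext hi⟩
  have hcard : Fintype.card (Fin m) = Fintype.card {v // v ≠ x₀} := by
    rw [Fintype.card_fin, Fintype.card_subtype_compl, hm, Fintype.card_subtype_eq,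
      Nat.add_sub_cancel]
  have hinj := ((Fintype.bijective_iff_surjective_and_card f).2 ⟨hf, hcard⟩).1
  exact fun i j hij => hinj (Subtype.ext hij)

/-- The graph formed by the edges listed before `e i`. -/
def initialGraph (e : Fin m → V × V) (i : Fin m) : SimpleGraph V :=
  SimpleGraph.fromEdgeSet ((fun j => s((e j).1, (e j).2)) '' {j | j < i})

lemma exists_of_initialGraph_adj {i : Fin m} {u v : V} (h : (initialGraph e i).Adj u v) :
    ∃ j < i, ((e j).1 = u ∧ (e j).2 = v) ∨ ((e j).1 = v ∧ (e j).2 = u) := by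
  obtain ⟨⟨j, hj, hje⟩, -⟩ := h
  exact ⟨j, hj, Sym2.eq_iff.1 hje⟩

/-- The end of an edge is isolated as long as that edge has not been added. -/
lemma _root_.IsLevelOrdering.not_initialGraph_adj [Fintype V] (he : IsLevelOrdering G x₀ e)
    (hG : G.Connected) (hm : Fintype.card V = m + 1) {i b : Fin m} (hib : i ≤ b) (a : V) :
    ¬ (initialGraph e i).Adj (e b).2 a := by
  intro h
  obtain ⟨j, hj, ⟨h1, -⟩ | ⟨-, h2⟩⟩ := exists_of_initialGraph_adj h
  · have h3 := he.level j b (hj.le.trans hib)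
    rw [he.away j, h1] at h3
    omega
  · exact (hj.trans_le hib).ne (he.snd_injective hG hm h2)

/-- If `e_b` is listed after `e_a` and starts elsewhere, then no edge starting where `e_b` starts is
listed before `e_a`. So the start of `e_b` has at most one neighbour in an initial graph not
containing `e_a`, namely its parent. -/
lemma _root_.IsLevelOrdering.isFree [Fintype V] (he : IsLevelOrdering G x₀ e)
    (hG : G.Connected) (hm : Fintype.card V = m + 1) {i a b : Fin m} (hia : i ≤ a)
    (hab : a ≤ b) : IsFree (completeAt (initialGraph e i) (e a).1) (e b).1 := by
  by_cases hba : (e b).1 = (e a).1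
  · rw [hba]
    exact isFree_completeAt_self
  refine IsFree.completeAt (isFree_of_subsingleton fun c d hc hd => ?_)
  have hbx : (e b).1 ≠ x₀ := by
    intro hbx
    have h := he.level a b hab
    rw [he.away, he.away, hbx, SimpleGraph.dist_self] at h
    exact hba (hbx.trans (hG.dist_eq_zero_iff.1 (by omega : G.dist x₀ (e a).1 = 0)))
  have key : ∀ c, (initialGraph e i).Adj (e b).1 c → ∃ j, (e j).1 = c ∧ (e j).2 = (e b).1 := by
    intro c hc
    obtain ⟨j, hj, ⟨h1, -⟩ | h⟩ := exists_of_initialGraph_adj hc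
    · exfalso
      have hja := hj.le.trans hia
      by_cases hax : (e a).1 = x₀
      · have h2 := he.level j a hja
        rw [he.away, he.away, h1, hax, SimpleGraph.dist_self] at h2
        exact hbx ((hG.dist_eq_zero_iff.1 (by omega : G.dist x₀ (e b).1 = 0)).symm)
      · obtain ⟨p, hp⟩ := he.exists_snd_eq hG hax
        obtain ⟨q, hq⟩ := he.exists_snd_eq hG hbx
        have hpq := he.left_to_right p q a b hp hq hab
        have hqp := he.left_to_right q p j a (hq.trans h1.symm) hp hja
        rw [← hp, ← hq, le_antisymm hpq hqp] at hba
        exact hba rfl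
    · exact ⟨j, h⟩
  obtain ⟨j, hj1, hj2⟩ := key c hc
  obtain ⟨k, hk1, hk2⟩ := key d hd
  rw [← hj1, ← hk1, he.snd_injective hG hm (hj2.trans hk2.symm)]

/-- With `H` the initial graph and `u` the start of `e_a`, the colon ideal of `f_{e_a}` is `J_{H_u}`,
modulo which `f_{e_b}` is a non-zero-divisor. -/
theorem _root_.IsLevelOrdering.isPSequence {K : Type*} [Field K] [Fintype V] [LinearOrder V]
    (he : IsLevelOrdering G x₀ e) (hG : G.Connected) (hm : Fintype.card V = m + 1) :
    IsPSequence fun i => edgeBinomial K s((e i).1, (e i).2) := by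
  have himage : ∀ s : Set (Fin m), (fun i => edgeBinomial K s((e i).1, (e i).2)) '' s =
      edgeBinomial K '' ((fun i => s((e i).1, (e i).2)) '' s) := fun s =>
    (Set.image_image _ _ _).symm
  have hne : ∀ i, (e i).1 ≠ (e i).2 := fun i h => by
    have := he.away i
    rw [h] at this
    omega
  refine ⟨fun i => ?_, fun i a b hia hab => le_antisymm ?_ ?_⟩
  · rw [himage]
    refine edgeBinomial_notMem_span (by simpa using hne i) ?_
    rintro ⟨j, hj, hji⟩
    exact hj (he.injective hji)
  · have hmem : ∀ c (g : MvPolynomial (V ⊕ V) K) (I : Ideal (MvPolynomial (V ⊕ V) K)),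
        g * edgeBinomial K s((e c).1, (e c).2) ∈ I ↔ g * minor K (e c).1 (e c).2 ∈ I := by
      intro c g I
      rcases edgeBinomial_mk (K := K) (e c).1 (e c).2 with h | h
      · rw [h]
      · rw [h, mul_neg, neg_mem_iff]
    intro g hg
    rw [Submodule.mem_colon_singleton, smul_eq_mul, himage, span_edgeBinomial_image] at hg ⊢
    change _ ∈ minorIdeal K (initialGraph e i) at hg ⊢
    rw [mul_left_comm, mul_comm, hmem,
      mul_minor_mem_iff (he.not_initialGraph_adj hG hm hia) (hne a), hmem] at hg
    rw [hmem, mul_minor_mem_iff (he.not_initialGraph_adj hG hm hia) (hne a)]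
    exact mem_of_mul_minor_mem (he.isFree hG hm hia hab)
      (not_adj_completeAt (he.not_initialGraph_adj hG hm (hia.trans hab))) (hne b) hg
  · intro g hg
    rw [Submodule.mem_colon_singleton, smul_eq_mul] at hg ⊢
    rw [← mul_assoc]
    exact Ideal.mul_mem_right _ _ hg

/-- The number with base `B` digits `d v, d (p v), d (p (p v)), …` (`k` digits, the least
significant first). -/
def pathCode (B : ℕ) (d : V → ℕ) (p : V → V) : ℕ → V → ℕ
  | 0, _ => 0
  | k + 1, v => pathCode B d p k (p v) * B + d v

/-- A level ordering exists. The path from the root to a vertex is read as a number in a base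
exceeding all its digits, each vertex having its own positive digit. In the resulting order of the
vertices longer paths come later, and the order of two vertices refines that of their parents. -/
theorem exists_isLevelOrdering [Fintype V] (hG : G.IsTree) (hm : Fintype.card V = m + 1) (x₀ : V) :
    ∃ e : Fin m → V × V, IsLevelOrdering G x₀ e := by
  classical
  choose p hp using fun v : {v // v ≠ x₀} => exists_parent hG.connected x₀ v.2
  let par : V → V := fun v => if h : v ≠ x₀ then p ⟨v, h⟩ else x₀
  have hpar : ∀ v, v ≠ x₀ → G.Adj (par v) v ∧ G.dist x₀ v = G.dist x₀ (par v) + 1 := by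
    intro v hv
    simp only [par, dif_pos hv]
    exact hp ⟨v, hv⟩
  let dig : V → ℕ := fun v => Fintype.equivFin V v + 1
  let B := Fintype.card V + 1
  have hdig : ∀ v, dig v < B := fun v => Nat.succ_lt_succ (Fintype.equivFin V v).isLt
  have hdig_inj : ∀ v w, dig v = dig w → v = w := fun v w h =>
    (Fintype.equivFin V).injective (Fin.ext (Nat.succ_injective h))
  let code : V → ℕ := fun v => pathCode B dig par (G.dist x₀ v) v
  have hroot : code x₀ = 0 := by simp [code, pathCode]
  have hcode : ∀ v, v ≠ x₀ → code v = code (par v) * B + dig v := by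
    intro v hv
    simp only [code]
    rw [(hpar v hv).2, pathCode]
  have hpos : ∀ v, v ≠ x₀ → 0 < code v := by
    intro v hv
    rw [hcode v hv]
    exact Nat.add_pos_right _ (Nat.succ_pos _)
  have hmod : ∀ v, v ≠ x₀ → code v % B = dig v := by
    intro v hv
    rw [hcode v hv, mul_comm, Nat.mul_add_mod, Nat.mod_eq_of_lt (hdig v)]
  have hdiv : ∀ v, v ≠ x₀ → code v / B = code (par v) := by
    intro v hv
    rw [hcode v hv, mul_comm, Nat.mul_add_div (Nat.succ_pos _), Nat.div_eq_of_lt (hdig v),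
      add_zero]
  have hinj : ∀ v w, v ≠ x₀ → w ≠ x₀ → code v = code w → v = w := fun v w hv hw h =>
    hdig_inj v w (by rw [← hmod v hv, ← hmod w hw, h])
  have hpar_le : ∀ v w, v ≠ x₀ → w ≠ x₀ → code v ≤ code w → code (par v) ≤ code (par w) :=
    fun v w hv hw h => by
      rw [← hdiv v hv, ← hdiv w hw]
      exact Nat.div_le_div_right h
  have hdist : ∀ k v w, G.dist x₀ v = k → code v ≤ code w → k ≤ G.dist x₀ w := by
    intro k
    induction k with
    | zero => intros; exact Nat.zero_le _
    | succ k ih =>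
      intro v w hv hvw
      have hv0 : v ≠ x₀ := by
        rintro rfl
        simp at hv
      have hw0 : w ≠ x₀ := by
        rintro rfl
        have := hpos v hv0
        omega
      rw [(hpar w hw0).2]
      have h1 := (hpar v hv0).2
      exact Nat.succ_le_succ (ih (par v) (par w) (by omega) (hpar_le v w hv0 hw0 hvw))
  have hcard : Fintype.card {v // v ≠ x₀} = m := by
    rw [Fintype.card_subtype_compl, hm, Fintype.card_subtype_eq, Nat.add_sub_cancel]
  let ε : Fin m ≃ {v // v ≠ x₀} := (Fintype.equivFinOfCardEq hcard).symm
  let σ := Tuple.sort fun i => code (ε i)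
  have hσ : Monotone fun i => code (ε (σ i)) := Tuple.monotone_sort fun i => code (ε i)
  let v : Fin m → V := fun i => ε (σ i)
  have hv : ∀ i, v i ≠ x₀ := fun i => (ε (σ i)).2
  have hv_inj : Function.Injective v := fun i j h => σ.injective (ε.injective (Subtype.ext h))
  have hedge_inj : Function.Injective fun i => s(par (v i), v i) := by
    intro i j hij
    rcases Sym2.eq_iff.1 hij with ⟨-, h⟩ | ⟨h1, h2⟩
    · exact hv_inj h
    · have h3 := (hpar _ (hv i)).2
      have h4 := (hpar _ (hv j)).2
      rw [h1] at h3
      rw [← h2] at h4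
      omega
  refine ⟨fun i => (par (v i), v i), fun i => (hpar _ (hv i)).2, hedge_inj, ?_,
    fun i j hij => hdist _ _ _ rfl (hσ hij), fun a b i j ha hb hij => ?_⟩
  · -- Both sides have `m` elements.
    have hsub : (Set.range fun i => s(par (v i), v i)) ⊆ G.edgeSet := by
      rintro _ ⟨i, rfl⟩
      exact (hpar _ (hv i)).1
    refine Set.eq_of_subset_of_ncard_le hsub ?_ (Set.toFinite _)
    rw [← Set.image_univ, Set.ncard_image_of_injective _ hedge_inj, Set.ncard_univ, Nat.card_fin]
    have := hG.card_edgeFinset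
    rw [← SimpleGraph.coe_edgeFinset, Set.ncard_coe_finset]
    omega
  · have h1 : code (v a) ≤ code (v b) := by
      change v a = par (v i) at ha
      change v b = par (v j) at hb
      rw [ha, hb]
      exact hpar_le _ _ (hv i) (hv j) (hσ hij)
    by_contra! hba
    have h2 : code (v b) ≤ code (v a) := hσ hba.le
    exact hba.ne (hv_inj (hinj _ _ (hv b) (hv a) (le_antisymm h2 h1)))

lemma exists_isPendant [Fintype V] [Nontrivial V] (hG : G.IsTree) : ∃ v, IsPendant G v := by
  classical
  obtain ⟨v, hv⟩ := hG.exists_vert_degree_one_of_nontrivial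
  exact ⟨v, SimpleGraph.degree_eq_one_iff_existsUnique_adj.1 hv⟩

end Level

end BinomialEdge

theorem mainTheorem2 {K : Type*} [Field K] (n : ℕ) (G : SimpleGraph (Fin (n + 1)))
    (hG : G.IsTree) :
    (∀ x₀ : Fin (n + 1), IsPendant G x₀ →
      (∃ e : Fin n → Fin (n + 1) × Fin (n + 1), IsLevelOrdering G x₀ e) ∧
      ∀ e : Fin n → Fin (n + 1) × Fin (n + 1), IsLevelOrdering G x₀ e →
        Ideal.span (Set.range fun i => edgeBinomial K s((e i).1, (e i).2)) =
            binomialEdgeIdeal K G ∧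
          IsPSequence fun i => edgeBinomial K s((e i).1, (e i).2)) ∧
    IsPSequenceIdeal (binomialEdgeIdeal K G) := by
  have hcard : Fintype.card (Fin (n + 1)) = n + 1 := Fintype.card_fin _
  have main : ∀ x₀ : Fin (n + 1), IsPendant G x₀ →
      (∃ e : Fin n → Fin (n + 1) × Fin (n + 1), IsLevelOrdering G x₀ e) ∧
      ∀ e : Fin n → Fin (n + 1) × Fin (n + 1), IsLevelOrdering G x₀ e →
        Ideal.span (Set.range fun i => edgeBinomial K s((e i).1, (e i).2)) =
            binomialEdgeIdeal K G ∧
          IsPSequence fun i => edgeBinomial K s((e i).1, (e i).2) := by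
    refine fun x₀ _ => ⟨BinomialEdge.exists_isLevelOrdering hG hcard x₀, fun e he => ⟨?_,
      he.isPSequence hG.connected hcard⟩⟩
    rw [binomialEdgeIdeal, ← he.range_eq, ← Set.range_comp]
    rfl
  refine ⟨main, ?_⟩
  rcases n with _ | n
  · -- A single vertex has no pendant vertex; its edge ideal is zero, generated by no elements.
    refine ⟨0, Fin.elim0, ?_, fun i => i.elim0, fun i => i.elim0⟩
    have : Subsingleton (Fin (0 + 1)) := inferInstanceAs (Subsingleton (Fin 1))
    have : G = ⊥ := Subsingleton.elim _ _
    rw [binomialEdgeIdeal, this, SimpleGraph.edgeSet_bot, Set.image_empty, Set.range_eq_empty]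
  · obtain ⟨x₀, hx₀⟩ := BinomialEdge.exists_isPendant hG
    obtain ⟨⟨e, he⟩, h⟩ := main x₀ hx₀
    exact ⟨_, _, h e he⟩
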